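/- Let $\mathcal{F}_\infty := C^\ast(x_1,x_2,\ldots \mid \|x_i\|\le 1)$ be the universal $C^\ast$-algebra generated by countably many contractions. For $C^\ast$-algebras $A$ and $B$, let $A\ast B$ denote their (full, non-unital) free product. Morphisms between $C^\ast$-algebras are $\ast$-homomorphisms, not necessarily unital, and ideals are closed and two-sided. A $C^\ast$-algebra $A$ is called projective if for every $C^\ast$-algebra $C$, every ideal $J\lhd C$ and every morphism $\sigma\colon A\to C/J$ there is a morphism $\psi\colon A\to C$ with $\pi\circ\psi=\sigma$, where $\pi\colon C\to C/J$ is the quotient morphism. It is called semiprojective if for every $C^\ast$-algebra $C$, every increasing sequence of ideals $J_1\subset J_2\subset\cdots$ of $C$ and every morphism $\sigma\colon A\to C/\overline{\bigcup_k J_k}$ there are an index $k$ and a morphism $\psi\colon A\to C/J_k$ with $\pi_k\circ\psi=\sigma$, where $\pi_k\colon C/J_k\to C/\overline{\bigcup_k J_k}$ is the quotient morphism. Let $(A_k,\gamma_k)$ be an inductive system of separable $C^\ast$-algebras, i.e. a sequence $A_1,A_2,\ldots$ of separable $C^\ast$-algebras with morphisms $\gamma_k\colon A_k\to A_{k+1}$,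 and put $B_k:=A_k\ast\mathcal{F}_\infty$. Then there exist surjective morphisms $\delta_k\colon B_k\to B_{k+1}$ such that $$\varinjlim (A_k,\gamma_k)\;\cong\;\varinjlim (B_k,\delta_k).$$ Moreover, for each $k$: if $A_k$ is projective, then so is $B_k$; and if $A_k$ is semiprojective, then so is $B_k$. -/

import Mathlib

open scoped NNReal

universe u v

noncomputable section

/-! ### The free complex `*`-algebra on a type of generators -/

/-- The involution on words in the letters `x` (`Sum.inl x`) and `x*` (`Sum.inr x`): it reverses
a word and exchanges the letters `x` and `x*`. -/
def starWord {X : Type u} : FreeSemigroup (X ⊕ X) →ₙ* (FreeSemigroup (X ⊕ X))ᵐᵒᵖ :=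
  FreeSemigroup.lift fun l => MulOpposite.op (FreeSemigroup.of l.swap)

/-- The free (non-unital) complex `*`-algebra on `X`: non-commutative polynomials without constant
term in the letters `x` and `x*`. -/
def FreeStarAlg (X : Type u) : Type u := MonoidAlgebra ℂ (FreeSemigroup (X ⊕ X))

namespace FreeStarAlg

variable {X : Type u}

instance : NonUnitalRing (FreeStarAlg X) :=
  inferInstanceAs (NonUnitalRing (MonoidAlgebra ℂ (FreeSemigroup (X ⊕ X))))

instance : Module ℂ (FreeStarAlg X) :=
  inferInstanceAs (Module ℂ (MonoidAlgebra ℂ (FreeSemigroup (X ⊕ X))))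

instance : IsScalarTower ℂ (FreeStarAlg X) (FreeStarAlg X) :=
  inferInstanceAs (IsScalarTower ℂ (MonoidAlgebra ℂ (FreeSemigroup (X ⊕ X)))
    (MonoidAlgebra ℂ (FreeSemigroup (X ⊕ X))))

instance : SMulCommClass ℂ (FreeStarAlg X) (FreeStarAlg X) :=
  inferInstanceAs (SMulCommClass ℂ (MonoidAlgebra ℂ (FreeSemigroup (X ⊕ X)))
    (MonoidAlgebra ℂ (FreeSemigroup (X ⊕ X))))

/-- The scalar multiple `c w` of a word `w`. -/
def single (w : FreeSemigroup (X ⊕ X)) (c : ℂ) : FreeStarAlg X := MonoidAlgebra.single w c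

/-- The generator `x`. -/
def of (x : X) : FreeStarAlg X := single (FreeSemigroup.of (Sum.inl x)) 1

theorem single_mul (w w' : FreeSemigroup (X ⊕ X)) (c c' : ℂ) :
    single w c * single w' c' = single (w * w') (c * c') :=
  MonoidAlgebra.single_mul_single ..

theorem smul_single (w : FreeSemigroup (X ⊕ X)) (a c : ℂ) :
    a • single w c = single w (a * c) :=
  MonoidAlgebra.smul_single ..

theorem addHom_ext {N : Type v} [AddZeroClass N] {f g : FreeStarAlg X →+ N}
    (h : ∀ w c, f (single w c) = g (single w c)) : f = g :=
  MonoidAlgebra.addMonoidHom_ext h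

theorem starWord_starWord (w : FreeSemigroup (X ⊕ X)) :
    (starWord (starWord w).unop).unop = w := by
  induction w with
  | ih1 l => simp [starWord]
  | ih2 l w h1 h2 => simp only [map_mul, MulOpposite.unop_mul, h1, h2]

/-- The involution as an additive map: `∑ c w ↦ ∑ c̄ w*`. -/
def starAdd : FreeStarAlg X →+ FreeStarAlg X :=
  (Finsupp.liftAddHom fun w : FreeSemigroup (X ⊕ X) =>
    (MonoidAlgebra.singleAddHom (R := ℂ) (starWord w).unop).comp
      (starAddEquiv (R := ℂ)).toAddMonoidHom).comp
    (MonoidAlgebra.coeffAddEquiv (R := ℂ) (M := FreeSemigroup (X ⊕ X))).toAddMonoidHom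

theorem starAdd_single (w : FreeSemigroup (X ⊕ X)) (c : ℂ) :
    starAdd (single w c) = single (starWord w).unop (star c) :=
  Finsupp.liftAddHom_apply_single _ w c

theorem starAdd_starAdd (a : FreeStarAlg X) : starAdd (starAdd a) = a := by
  have : (starAdd.comp starAdd : FreeStarAlg X →+ FreeStarAlg X) = AddMonoidHom.id _ :=
    addHom_ext fun w c => by simp [starAdd_single, starWord_starWord]
  exact DFunLike.congr_fun this a

theorem starAdd_mul (a b : FreeStarAlg X) : starAdd (a * b) = starAdd b * starAdd a := by
  have : (AddMonoidHom.mul : FreeStarAlg X →+ _ →+ _).compr₂ starAdd =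
      ((AddMonoidHom.mul : FreeStarAlg X →+ _ →+ _).flip.comp starAdd).compl₂ starAdd :=
    addHom_ext fun w c => addHom_ext fun w' c' => by
      simp [starAdd_single, single_mul, mul_comm]
  exact DFunLike.congr_fun (DFunLike.congr_fun this a) b

instance : StarRing (FreeStarAlg X) where
  star := starAdd
  star_involutive := starAdd_starAdd
  star_mul := starAdd_mul
  star_add := map_add starAdd

theorem star_single (w : FreeSemigroup (X ⊕ X)) (c : ℂ) :
    star (single w c) = single (starWord w).unop (star c) := starAdd_single w c

instance : StarModule ℂ (FreeStarAlg X) where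
  star_smul r a := by
    have : (starAdd.comp (DistribSMul.toAddMonoidHom (FreeStarAlg X) r)) =
        (DistribSMul.toAddMonoidHom (FreeStarAlg X) (star r)).comp starAdd :=
      addHom_ext fun w c => by simp [starAdd_single, smul_single]
    exact DFunLike.congr_fun this a

end FreeStarAlg

/-! ### Universal C*-algebras given by generators and relations -/

/-- Generators `X`, a norm bound for each generator, and a set of `*`-polynomials in the generators
that are required to vanish. -/
structure CStarPresentation (X : Type u) where
  bound : X → ℝ≥0
  rel : Set (FreeStarAlg X)

/-- A seminorm `p` on the free `*`-algebra is a C*-seminorm compatible with the presentation. -/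
structure CStarPresentation.Admissible {X : Type u} (P : CStarPresentation X)
    (p : Seminorm ℂ (FreeStarAlg X)) : Prop where
  mul_le : ∀ a b, p (a * b) ≤ p a * p b
  star_mul_self : ∀ a, p (star a * a) = p a * p a
  le_bound : ∀ x, p (FreeStarAlg.of x) ≤ P.bound x
  rel_eq_zero : ∀ r ∈ P.rel, p r = 0

namespace CStarPresentation

variable {X : Type u} (P : CStarPresentation X)

/-- The free `*`-algebra, to be equipped with the largest admissible C*-seminorm. -/
def Pre (_P : CStarPresentation X) : Type u := FreeStarAlg X

/-- The identity map onto the free `*`-algebra with its new seminorm. -/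
def toPre (a : FreeStarAlg X) : P.Pre := a

instance : NonUnitalRing P.Pre := inferInstanceAs (NonUnitalRing (FreeStarAlg X))
instance : Module ℂ P.Pre := inferInstanceAs (Module ℂ (FreeStarAlg X))
instance : IsScalarTower ℂ P.Pre P.Pre :=
  inferInstanceAs (IsScalarTower ℂ (FreeStarAlg X) (FreeStarAlg X))
instance : SMulCommClass ℂ P.Pre P.Pre :=
  inferInstanceAs (SMulCommClass ℂ (FreeStarAlg X) (FreeStarAlg X))
instance : StarRing P.Pre := inferInstanceAs (StarRing (FreeStarAlg X))
instance : StarModule ℂ P.Pre := inferInstanceAs (StarModule ℂ (FreeStarAlg X))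

/-- The largest admissible C*-seminorm: the supremum of all of them. -/
def maxNorm (a : FreeStarAlg X) : ℝ := ⨆ p : {p : Seminorm ℂ (FreeStarAlg X) // P.Admissible p}, p.1 a

variable {P}

theorem Admissible.star_eq {p : Seminorm ℂ (FreeStarAlg X)} (hp : P.Admissible p)
    (a : FreeStarAlg X) : p (star a) = p a := by
  have key : ∀ b, p b ≤ p (star b) := fun b => by
    by_contra! h
    have h0 : 0 < p b := (apply_nonneg p _).trans_lt h
    have := hp.mul_le (star b) b
    rw [hp.star_mul_self] at this
    nlinarith
  exact le_antisymm (by simpa using key (star a)) (key a)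

variable (P)

theorem admissible_zero : P.Admissible 0 := by
  constructor <;> intros <;> simp

instance : Nonempty {p : Seminorm ℂ (FreeStarAlg X) // P.Admissible p} := ⟨⟨0, P.admissible_zero⟩⟩

theorem exists_bound_word (w : FreeSemigroup (X ⊕ X)) :
    ∃ M : ℝ, ∀ p, P.Admissible p → p (FreeStarAlg.single w 1) ≤ M := by
  induction w with
  | ih1 l =>
    rcases l with x | x
    · exact ⟨P.bound x, fun p hp => hp.le_bound x⟩
    · refine ⟨P.bound x, fun p hp => ?_⟩
      have : FreeStarAlg.single (FreeSemigroup.of (Sum.inr x)) 1 = star (FreeStarAlg.of x) := by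
        simp [FreeStarAlg.of, FreeStarAlg.star_single, starWord]
      rw [this, hp.star_eq]
      exact hp.le_bound x
  | ih2 l w h1 h2 =>
    obtain ⟨M, hM⟩ := h1
    obtain ⟨N, hN⟩ := h2
    refine ⟨M * N, fun p hp => ?_⟩
    have := hp.mul_le (FreeStarAlg.single (FreeSemigroup.of l) 1) (FreeStarAlg.single w 1)
    rw [FreeStarAlg.single_mul, one_mul] at this
    exact this.trans (mul_le_mul (hM p hp) (hN p hp) (apply_nonneg p _)
      ((apply_nonneg p _).trans (hM p hp)))

theorem exists_bound (a : FreeStarAlg X) : ∃ M : ℝ, ∀ p, P.Admissible p → p a ≤ M := by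
  let S : AddSubmonoid (FreeStarAlg X) :=
    { carrier := {a | ∃ M : ℝ, ∀ p, P.Admissible p → p a ≤ M}
      zero_mem' := ⟨0, fun p _ => by simp⟩
      add_mem' := by
        rintro a b ⟨M, hM⟩ ⟨N, hN⟩
        exact ⟨M + N, fun p hp => (map_add_le_add p a b).trans (add_le_add (hM p hp) (hN p hp))⟩ }
  have hS : ∀ w c, FreeStarAlg.single w c ∈ S := fun w c => by
    obtain ⟨M, hM⟩ := P.exists_bound_word w
    refine ⟨‖c‖ * M, fun p hp => ?_⟩
    have : FreeStarAlg.single w c = c • FreeStarAlg.single w 1 := by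
      rw [FreeStarAlg.smul_single, mul_one]
    rw [this, map_smul_eq_mul]
    exact mul_le_mul_of_nonneg_left (hM p hp) (norm_nonneg c)
  suffices a ∈ S from this
  have : ∀ f : FreeSemigroup (X ⊕ X) →₀ ℂ, (MonoidAlgebra.ofCoeff f : FreeStarAlg X) ∈ S := by
    intro f
    induction f using Finsupp.induction_linear with
    | zero => exact S.zero_mem
    | add f g hf hg => exact S.add_mem hf hg
    | single w c => exact hS w c
  exact this (MonoidAlgebra.coeff a)

theorem bddAbove (a : FreeStarAlg X) : BddAbove (Set.range
    fun p : {p : Seminorm ℂ (FreeStarAlg X) // P.Admissible p} => p.1 a) := by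
  obtain ⟨M, hM⟩ := P.exists_bound a
  exact ⟨M, by rintro _ ⟨p, rfl⟩; exact hM p.1 p.2⟩

variable {P} in
theorem Admissible.le_maxNorm {p : Seminorm ℂ (FreeStarAlg X)} (hp : P.Admissible p)
    (a : FreeStarAlg X) : p a ≤ P.maxNorm a :=
  le_ciSup (P.bddAbove a) ⟨p, hp⟩

theorem maxNorm_le {a : FreeStarAlg X} {M : ℝ} (h : ∀ p, P.Admissible p → p a ≤ M) :
    P.maxNorm a ≤ M :=
  ciSup_le fun p => h p.1 p.2

theorem maxNorm_nonneg (a : FreeStarAlg X) : 0 ≤ P.maxNorm a :=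
  P.admissible_zero.le_maxNorm a

/-- The largest admissible C*-seminorm as a seminorm. -/
def maxSeminorm : Seminorm ℂ (FreeStarAlg X) :=
  Seminorm.ofSMulLE P.maxNorm
    (le_antisymm (P.maxNorm_le fun p _ => by simp) (P.maxNorm_nonneg 0))
    (fun a b => P.maxNorm_le fun p hp => (map_add_le_add p a b).trans
      (add_le_add (hp.le_maxNorm a) (hp.le_maxNorm b)))
    (fun c a => P.maxNorm_le fun p hp => by
      rw [map_smul_eq_mul]
      exact mul_le_mul_of_nonneg_left (hp.le_maxNorm a) (norm_nonneg c))

theorem maxSeminorm_apply (a : FreeStarAlg X) : P.maxSeminorm a = P.maxNorm a := rfl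

theorem admissible_maxSeminorm : P.Admissible P.maxSeminorm where
  mul_le a b := P.maxNorm_le fun p hp => (hp.mul_le a b).trans
    (mul_le_mul (hp.le_maxNorm a) (hp.le_maxNorm b) (apply_nonneg p b) (P.maxNorm_nonneg a))
  star_mul_self a := by
    simp only [maxSeminorm_apply]
    refine le_antisymm (P.maxNorm_le fun p hp => ?_) ?_
    · rw [hp.star_mul_self]
      exact mul_self_le_mul_self (apply_nonneg p a) (hp.le_maxNorm a)
    · have : P.maxNorm a ≤ √(P.maxNorm (star a * a)) := P.maxNorm_le fun p hp =>
        Real.le_sqrt_of_sq_le (by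
          rw [sq, ← hp.star_mul_self]; exact hp.le_maxNorm _)
      calc P.maxNorm a * P.maxNorm a
          ≤ √(P.maxNorm (star a * a)) * √(P.maxNorm (star a * a)) :=
            mul_self_le_mul_self (P.maxNorm_nonneg a) this
        _ = _ := Real.mul_self_sqrt (P.maxNorm_nonneg _)
  le_bound x := P.maxNorm_le fun p hp => hp.le_bound x
  rel_eq_zero r hr := le_antisymm (P.maxNorm_le fun p hp => (hp.rel_eq_zero r hr).le)
    (P.maxNorm_nonneg r)

instance : Norm P.Pre := ⟨P.maxSeminorm⟩

instance : SeminormedAddCommGroup P.Pre :=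
  SeminormedAddCommGroup.ofCore (𝕜 := ℂ)
    { norm_nonneg := apply_nonneg P.maxSeminorm
      norm_smul := map_smul_eq_mul P.maxSeminorm
      norm_triangle := map_add_le_add P.maxSeminorm }

instance : NonUnitalSeminormedRing P.Pre where
  __ := (inferInstance : SeminormedAddCommGroup P.Pre)
  __ := (inferInstance : NonUnitalRing P.Pre)
  norm_mul_le := P.admissible_maxSeminorm.mul_le

instance : NormedSpace ℂ P.Pre where
  norm_smul_le c a := (map_smul_eq_mul P.maxSeminorm c a).le

theorem norm_star_pre (a : P.Pre) : ‖star a‖ = ‖a‖ := P.admissible_maxSeminorm.star_eq a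

theorem norm_star_mul_self_pre (a : P.Pre) : ‖star a * a‖ = ‖a‖ * ‖a‖ :=
  P.admissible_maxSeminorm.star_mul_self a

end CStarPresentation

open UniformSpace

/-- The universal C*-algebra of a presentation: the (Hausdorff) completion of the free `*`-algebra
with respect to the largest admissible C*-seminorm. -/
def UniversalCStar {X : Type u} (P : CStarPresentation X) : Type u := Completion P.Pre

namespace UniversalCStar

variable {X : Type u} (P : CStarPresentation X)

instance : NormedAddCommGroup (UniversalCStar P) :=
  inferInstanceAs (NormedAddCommGroup (Completion P.Pre))

instance : NormedSpace ℂ (UniversalCStar P) :=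
  inferInstanceAs (NormedSpace ℂ (Completion P.Pre))

instance : CompleteSpace (UniversalCStar P) :=
  inferInstanceAs (CompleteSpace (Completion P.Pre))

variable {P}

/-- The canonical map from the free `*`-algebra. -/
def mk (a : P.Pre) : UniversalCStar P := (a : Completion P.Pre)

/-- The image of the generator `x`. -/
def of (x : X) : UniversalCStar P := mk (P.toPre (FreeStarAlg.of x))

theorem isDenseInducing_mk : IsDenseInducing (mk : P.Pre → UniversalCStar P) :=
  Completion.isDenseInducing_coe

theorem continuous_mk : Continuous (mk : P.Pre → UniversalCStar P) := Completion.continuous_coe _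

theorem norm_mk (a : P.Pre) : ‖mk a‖ = ‖a‖ := Completion.norm_coe a

theorem mk_add (a b : P.Pre) : mk (a + b) = mk a + mk b := Completion.coe_add a b

theorem mk_smul (c : ℂ) (a : P.Pre) : mk (c • a) = c • mk a := Completion.coe_smul c a

/-- `mk` as an additive map. -/
def mkAdd : P.Pre →+ UniversalCStar P := AddMonoidHom.mk' mk mk_add

instance : Mul (UniversalCStar P) :=
  ⟨Function.curry ((isDenseInducing_mk.prodMap isDenseInducing_mk).extend
    (mk ∘ Function.uncurry (· * ·)))⟩

instance : Star (UniversalCStar P) := ⟨isDenseInducing_mk.extend (mk ∘ star)⟩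

theorem mk_mul (a b : P.Pre) : mk (a * b) = mk a * mk b :=
  ((isDenseInducing_mk.prodMap isDenseInducing_mk).extend_eq
    (continuous_mk.comp continuous_mul) (a, b)).symm

theorem continuous_star_pre : Continuous (star : P.Pre → P.Pre) :=
  (AddMonoidHomClass.isometry_of_norm (starAddEquiv (R := P.Pre)) P.norm_star_pre).continuous

theorem mk_star (a : P.Pre) : mk (star a) = star (mk a) :=
  (isDenseInducing_mk.extend_eq (continuous_mk.comp continuous_star_pre) a).symm

instance : ContinuousMul (UniversalCStar P) where
  continuous_mul := by
    let m := (AddMonoidHom.mul : P.Pre →+ P.Pre →+ P.Pre).compr₂ mkAdd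
    have hm : Continuous fun p : P.Pre × P.Pre => m p.1 p.2 := continuous_mk.comp continuous_mul
    have di : IsDenseInducing (mkAdd : P.Pre → UniversalCStar P) := isDenseInducing_mk
    exact (di.extend_Z_bilin di hm :)

instance : ContinuousStar (UniversalCStar P) where
  continuous_star := by
    have : UniformContinuous (mk ∘ star : P.Pre → UniversalCStar P) :=
      (Completion.uniformContinuous_coe P.Pre).comp
        (AddMonoidHomClass.isometry_of_norm (starAddEquiv (R := P.Pre))
          P.norm_star_pre).uniformContinuous
    exact (uniformContinuous_uniformly_extend (Completion.isUniformInducing_coe P.Pre)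
      isDenseInducing_mk.dense this).continuous

@[elab_as_elim]
theorem induction₁ {p : UniversalCStar P → Prop} (a : UniversalCStar P)
    (hp : IsClosed {a | p a}) (ih : ∀ a : P.Pre, p (mk a)) : p a :=
  Completion.induction_on a hp ih

@[elab_as_elim]
theorem induction₂ {p : UniversalCStar P → UniversalCStar P → Prop} (a b : UniversalCStar P)
    (hp : IsClosed {x : UniversalCStar P × UniversalCStar P | p x.1 x.2})
    (ih : ∀ a b : P.Pre, p (mk a) (mk b)) : p a b :=
  Completion.induction_on₂ a b hp ih

@[elab_as_elim]
theorem induction₃ {p : UniversalCStar P → UniversalCStar P → UniversalCStar P → Prop}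
    (a b c : UniversalCStar P)
    (hp : IsClosed {x : UniversalCStar P × UniversalCStar P × UniversalCStar P |
      p x.1 x.2.1 x.2.2})
    (ih : ∀ a b c : P.Pre, p (mk a) (mk b) (mk c)) : p a b c :=
  Completion.induction_on₃ a b c hp ih

theorem mk_zero : mk (0 : P.Pre) = 0 := map_zero mkAdd

instance : NonUnitalRing (UniversalCStar P) where
  __ := (inferInstance : AddCommGroup (UniversalCStar P))
  __ := (inferInstance : Mul (UniversalCStar P))
  zero_mul a := induction₁ a (isClosed_eq (by fun_prop) continuous_const)
    fun a => by rw [← mk_zero, ← mk_mul, zero_mul]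
  mul_zero a := induction₁ a (isClosed_eq (by fun_prop) continuous_const)
    fun a => by rw [← mk_zero, ← mk_mul, mul_zero]
  mul_assoc a b c := induction₃ a b c (isClosed_eq (by fun_prop) (by fun_prop))
    fun a b c => by simp only [← mk_mul, mul_assoc]
  left_distrib a b c := induction₃ a b c (isClosed_eq (by fun_prop) (by fun_prop))
    fun a b c => by simp only [← mk_mul, ← mk_add, mul_add]
  right_distrib a b c := induction₃ a b c (isClosed_eq (by fun_prop) (by fun_prop))
    fun a b c => by simp only [← mk_mul, ← mk_add, add_mul]

instance : NonUnitalNormedRing (UniversalCStar P) where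
  __ := (inferInstance : NormedAddCommGroup (UniversalCStar P))
  __ := (inferInstance : NonUnitalRing (UniversalCStar P))
  norm_mul_le a b := induction₂ a b (isClosed_le (by fun_prop) (by fun_prop))
    fun a b => by simpa only [← mk_mul, norm_mk] using norm_mul_le a b

instance : StarRing (UniversalCStar P) where
  star_involutive a := induction₁ a (isClosed_eq (by fun_prop) continuous_id)
    fun a => by rw [← mk_star, ← mk_star, star_star]
  star_mul a b := induction₂ a b (isClosed_eq (by fun_prop) (by fun_prop))
    fun a b => by simp only [← mk_mul, ← mk_star, star_mul]
  star_add a b := induction₂ a b (isClosed_eq (by fun_prop) (by fun_prop))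
    fun a b => by simp only [← mk_add, ← mk_star, star_add]

instance : CStarRing (UniversalCStar P) where
  norm_mul_self_le a := induction₁ a (isClosed_le (by fun_prop) (by fun_prop))
    fun a => by
      rw [← mk_star, ← mk_mul, norm_mk, norm_mk, P.norm_star_mul_self_pre]

instance : IsScalarTower ℂ (UniversalCStar P) (UniversalCStar P) where
  smul_assoc c a b := induction₂ a b
    (isClosed_eq ((continuous_fst.const_smul c).mul continuous_snd)
      ((continuous_fst.mul continuous_snd).const_smul c))
    fun a b => by simp only [smul_eq_mul, ← mk_smul, ← mk_mul, smul_mul_assoc]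

instance : SMulCommClass ℂ (UniversalCStar P) (UniversalCStar P) where
  smul_comm c a b := induction₂ a b
    (isClosed_eq ((continuous_fst.mul continuous_snd).const_smul c)
      (continuous_fst.mul (continuous_snd.const_smul c)))
    fun a b => by simp only [smul_eq_mul, ← mk_smul, ← mk_mul, mul_smul_comm]

instance : StarModule ℂ (UniversalCStar P) where
  star_smul c a := induction₁ a
    (isClosed_eq (continuous_id.const_smul c).star (continuous_id.star.const_smul (star c)))
    fun a => by simp only [← mk_smul, ← mk_star, star_smul]

instance : NonUnitalCStarAlgebra (UniversalCStar P) where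

end UniversalCStar

/-! ### The free C*-algebra on countably many contractions, free products, inductive limits -/

/-- Countably many generators `x₀, x₁, …`, subject to `‖xᵢ‖ ≤ 1`. -/
def FInftyPres : CStarPresentation ℕ where
  bound _ := 1
  rel := ∅

/-- The universal C*-algebra `C*(x₀, x₁, … | ‖xᵢ‖ ≤ 1)` on countably many contractions. -/
abbrev FInfty : Type := UniversalCStar FInftyPres

/-- The relations which say that the generators `j a`, `a ∈ A`, depend on `a` through a
`*`-homomorphism. -/
inductive StarHomRel {X : Type u} {A : Type v} [NonUnitalCStarAlgebra A] (j : A → X) :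
    FreeStarAlg X → Prop
  | add (a b : A) : StarHomRel j
      (FreeStarAlg.of (j (a + b)) - (FreeStarAlg.of (j a) + FreeStarAlg.of (j b)))
  | smul (c : ℂ) (a : A) : StarHomRel j (FreeStarAlg.of (j (c • a)) - c • FreeStarAlg.of (j a))
  | mul (a b : A) : StarHomRel j (FreeStarAlg.of (j (a * b)) - FreeStarAlg.of (j a) * FreeStarAlg.of (j b))
  | star (a : A) : StarHomRel j (FreeStarAlg.of (j (star a)) - star (FreeStarAlg.of (j a)))

/-- Generators `A ⊔ B`, subject to the relations that `A` and `B` are mapped by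
`*`-homomorphisms. The norm bound on the generators is automatic, since `*`-homomorphisms between
C*-algebras are contractive. -/
def freeProductPres (A : Type u) (B : Type v) [NonUnitalCStarAlgebra A]
    [NonUnitalCStarAlgebra B] : CStarPresentation (A ⊕ B) where
  bound := Sum.elim (fun a => ‖a‖₊) (fun b => ‖b‖₊)
  rel := {r | StarHomRel Sum.inl r ∨ StarHomRel Sum.inr r}

/-- The (full, non-unital) free product of two C*-algebras: the universal C*-algebra generated by
`*`-homomorphic images of `A` and `B`. -/
abbrev FreeProduct (A : Type u) (B : Type v) [NonUnitalCStarAlgebra A] [NonUnitalCStarAlgebra B] :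
    Type (max u v) :=
  UniversalCStar (freeProductPres A B)

/-- Generators `⊔ₖ A k`, subject to the relations that every `A k` is mapped by a
`*`-homomorphism and that `a ∈ A k` and `γ k a ∈ A (k + 1)` have the same image. The norm bound on
the generators is again automatic. -/
def inductiveLimitPres {A : ℕ → Type u} [∀ k, NonUnitalCStarAlgebra (A k)]
    (γ : ∀ k, A k →⋆ₙₐ[ℂ] A (k + 1)) : CStarPresentation (Σ k, A k) where
  bound x := ‖x.2‖₊
  rel := {r | (∃ k, StarHomRel (Sigma.mk k) r) ∨
    ∃ k a, r = FreeStarAlg.of ⟨k + 1, γ k a⟩ - FreeStarAlg.of ⟨k, a⟩}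

/-- The inductive limit of a sequence of C*-algebras: the universal C*-algebra generated by
`*`-homomorphic images of all the `A k` that are compatible with the connecting morphisms. -/
abbrev InductiveLimit {A : ℕ → Type u} [∀ k, NonUnitalCStarAlgebra (A k)]
    (γ : ∀ k, A k →⋆ₙₐ[ℂ] A (k + 1)) : Type u :=
  UniversalCStar (inductiveLimitPres γ)

/-! ### Projective and semiprojective C*-algebras -/

/-- `π : C → D` is (up to isomorphism) the quotient morphism `C → C/J`. -/
def IsQuotientBy {C : Type u} {D : Type v} [NonUnitalCStarAlgebra C] [NonUnitalCStarAlgebra D]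
    (π : C →⋆ₙₐ[ℂ] D) (J : Set C) : Prop :=
  Function.Surjective π ∧ ∀ x, π x = 0 ↔ x ∈ J

/-- A morphism `φ : A → B` is projective if for every quotient morphism `π : C → C/J` by a closed
ideal and every `σ : B → C/J` there is `ψ : A → C` with `π ∘ ψ = σ ∘ φ`. -/
def IsProjectiveMorphism {A B : Type u} [NonUnitalCStarAlgebra A] [NonUnitalCStarAlgebra B]
    (φ : A →⋆ₙₐ[ℂ] B) : Prop :=
  ∀ (C D : Type u) [NonUnitalCStarAlgebra C] [NonUnitalCStarAlgebra D]
    (J : TwoSidedIdeal C), IsClosed (J : Set C) →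
    ∀ π : C →⋆ₙₐ[ℂ] D, IsQuotientBy π (J : Set C) →
    ∀ σ : B →⋆ₙₐ[ℂ] D, ∃ ψ : A →⋆ₙₐ[ℂ] C, π.comp ψ = σ.comp φ

/-- A C*-algebra is projective if its identity morphism is. -/
def IsProjectiveCStar (A : Type u) [NonUnitalCStarAlgebra A] : Prop :=
  IsProjectiveMorphism (NonUnitalStarAlgHom.id ℂ A)

/-- A morphism `φ : A → B` is semiprojective if for every increasing sequence of closed ideals
`J k` of `C`, with `D = C / closure (⋃ k, J k)`, and every `σ : B → D` there are `k` and
`ψ : A → C / J k` with `ρ ∘ ψ = σ ∘ φ`. Here `Q k` is `C / J k`, with quotient morphism `q k`,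
and `ρ : Q k → D` is the induced morphism, determined by `ρ ∘ q k = π`. -/
def IsSemiprojectiveMorphism {A B : Type u} [NonUnitalCStarAlgebra A] [NonUnitalCStarAlgebra B]
    (φ : A →⋆ₙₐ[ℂ] B) : Prop :=
  ∀ (C D : Type u) [NonUnitalCStarAlgebra C] [NonUnitalCStarAlgebra D]
    (Q : ℕ → Type u) [∀ k, NonUnitalCStarAlgebra (Q k)]
    (J : ℕ → TwoSidedIdeal C), Monotone J → (∀ k, IsClosed (J k : Set C)) →
    ∀ q : ∀ k, C →⋆ₙₐ[ℂ] Q k, (∀ k, IsQuotientBy (q k) (J k : Set C)) →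
    ∀ π : C →⋆ₙₐ[ℂ] D, IsQuotientBy π (closure (⋃ k, (J k : Set C))) →
    ∀ σ : B →⋆ₙₐ[ℂ] D, ∃ (k : ℕ) (ψ : A →⋆ₙₐ[ℂ] Q k) (ρ : Q k →⋆ₙₐ[ℂ] D),
      ρ.comp (q k) = π ∧ ρ.comp ψ = σ.comp φ

/-- A C*-algebra is semiprojective if its identity morphism is. -/
def IsSemiprojectiveCStar (A : Type u) [NonUnitalCStarAlgebra A] : Prop :=
  IsSemiprojectiveMorphism (NonUnitalStarAlgHom.id ℂ A)

end

/-!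
The morphism `δ k : A k * F∞ → A (k + 1) * F∞` extends `γ k` and sends the generators of `F∞` to
two kinds of contractions: a sequence that generates `A (k + 1)`, and the generators of `F∞`
themselves. Hence the range of `δ k` contains a generating set, and it is closed, so `δ k` is
surjective. In the limit nothing is added to `lim A k`, because each single generator of `F∞` is
consumed after finitely many steps: arranged as a double sequence `x i j`, the generators satisfy
`δ (x (i + 1) j) = x i j`, while `δ (x 0 j)` lies in `A (k + 1)`.

(Semi)projectivity passes to `A * F∞` because `F∞` has the strongest possible lifting property:
contractions lift to contractions along surjective morphisms of C*-algebras.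
-/

noncomputable section

open UniformSpace TopologicalSpace
open scoped CStarAlgebra

universe w

/-! ### Norm-preserving lifts -/

section NormPreservingLifts

variable {C : Type u} {D : Type v} [NonUnitalCStarAlgebra C] [NonUnitalCStarAlgebra D]

theorem abs_le_norm_of_mem_quasispectrum {a : C} (ha : IsSelfAdjoint a) {t : ℝ}
    (ht : t ∈ quasispectrum ℝ a) : |t| ≤ ‖a‖ := by
  simpa only [cfcₙ_id' ℝ a] using! norm_apply_le_norm_cfcₙ (fun t : ℝ => t) a ht

theorem star_mul_self_sub_mul_cfcₙ (c : C) {g : ℝ → ℝ}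
    (hg : ContinuousOn g (quasispectrum ℝ (star c * c))) (hg0 : g 0 = 0) :
    star (c - c * cfcₙ g (star c * c)) * (c - c * cfcₙ g (star c * c)) =
      cfcₙ (fun t => t * (1 - g t) ^ 2) (star c * c) := by
  set x := star c * c with hx
  have star_y : star (cfcₙ g x) = cfcₙ g x := (cfcₙ_predicate g x : IsSelfAdjoint _)
  have cfcₙ_id_x : cfcₙ (fun t : ℝ => t) x = x := cfcₙ_id' ℝ x (.star_mul_self c)
  have cfcₙ_one_sub : cfcₙ (fun t => t - t * g t) x = x - x * cfcₙ g x := by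
    rw [cfcₙ_sub (fun t => t) (fun t => t * g t) x, cfcₙ_mul (fun t => t) g x, cfcₙ_id_x]
  calc star (c - c * cfcₙ g x) * (c - c * cfcₙ g x)
      = (x - x * cfcₙ g x) - cfcₙ g x * (x - x * cfcₙ g x) := by
        rw [star_sub, star_mul, star_y, hx]
        noncomm_ring
    _ = cfcₙ (fun t => (t - t * g t) - g t * (t - t * g t)) x := by
        rw [cfcₙ_sub (fun t => t - t * g t) (fun t => g t * (t - t * g t)) x,
          cfcₙ_mul g (fun t => t - t * g t) x, cfcₙ_one_sub]
    _ = cfcₙ (fun t => t * (1 - g t) ^ 2) x := by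
        congr 1 with t
        ring

theorem map_sub_mul_cfcₙ (φ : C →⋆ₙₐ[ℂ] D) (c : C) {g : ℝ → ℝ}
    (hg : ContinuousOn g (quasispectrum ℝ (star c * c)))
    (hφ : (quasispectrum ℝ (φ (star c * c))).EqOn g 0) :
    φ (c - c * cfcₙ g (star c * c)) = φ c := by
  have hx : IsSelfAdjoint (star c * c) := .star_mul_self c
  have map_cfcₙ_eq_zero : φ (cfcₙ g (star c * c)) = 0 := by
    rw [NonUnitalStarAlgHomClass.map_cfcₙ φ g _ hg (hφ (quasispectrum.zero_mem ℝ _))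
      (map_continuous φ) hx (hx.map φ), cfcₙ_congr hφ]
    exact cfcₙ_zero ℝ _
  rw [map_sub, map_mul, map_cfcₙ_eq_zero, mul_zero, sub_zero]

/-- The function `g` for which `c - c g(c* c)` is the contraction `c / √(max 1 |c|²)`. It vanishes
at `0`, so `g(c* c)` makes sense in a non-unital algebra. -/
def contractionCutoff (t : ℝ) : ℝ := 1 - (√(max 1 |t|))⁻¹

theorem continuous_contractionCutoff : Continuous contractionCutoff := by
  have sqrt_ne_zero (t : ℝ) : √(max 1 |t|) ≠ 0 := (Real.sqrt_pos.2 (by positivity)).ne'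
  have continuous_sqrt : Continuous fun t : ℝ => √(max 1 |t|) := by fun_prop
  exact continuous_const.sub (continuous_sqrt.inv₀ sqrt_ne_zero)

theorem contractionCutoff_of_abs_le_one {t : ℝ} (ht : |t| ≤ 1) : contractionCutoff t = 0 := by
  simp [contractionCutoff, max_eq_left ht]

theorem abs_mul_one_sub_contractionCutoff_sq_le_one (t : ℝ) :
    |t * (1 - contractionCutoff t) ^ 2| ≤ 1 := by
  have max_pos : (0 : ℝ) < max 1 |t| := by positivity
  calc |t * (1 - contractionCutoff t) ^ 2| = |t| / max 1 |t| := by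
        rw [contractionCutoff, sub_sub_cancel, inv_pow, Real.sq_sqrt max_pos.le, abs_mul, abs_inv,
          abs_of_pos max_pos, div_eq_mul_inv]
    _ ≤ 1 := div_le_one_of_le₀ (le_max_right _ _) max_pos.le

theorem exists_map_eq_norm_le_one (φ : C →⋆ₙₐ[ℂ] D) (c : C) (hc : ‖φ c‖ ≤ 1) :
    ∃ c', φ c' = φ c ∧ ‖c'‖ ≤ 1 := by
  have hg := continuous_contractionCutoff.continuousOn (s := quasispectrum ℝ (star c * c))
  have norm_map_le_one : ‖φ (star c * c)‖ ≤ 1 := by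
    rw [map_mul, map_star, CStarRing.norm_star_mul_self]
    exact mul_le_one₀ hc (norm_nonneg _) hc
  refine ⟨c - c * cfcₙ contractionCutoff (star c * c), map_sub_mul_cfcₙ φ c hg fun t ht => ?_, ?_⟩
  · have hx : IsSelfAdjoint (φ (star c * c)) := .map (.star_mul_self c) φ
    exact contractionCutoff_of_abs_le_one
      ((abs_le_norm_of_mem_quasispectrum hx ht).trans norm_map_le_one)
  · refine (sq_le_one_iff₀ (norm_nonneg _)).1 ?_
    rw [sq, ← CStarRing.norm_star_mul_self,
      star_mul_self_sub_mul_cfcₙ c hg (contractionCutoff_of_abs_le_one (by simp))]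
    exact norm_cfcₙ_le fun t _ => abs_mul_one_sub_contractionCutoff_sq_le_one t

theorem exists_map_eq_norm_le (φ : C →⋆ₙₐ[ℂ] D) (c : C) :
    ∃ c', φ c' = φ c ∧ ‖c'‖ ≤ ‖φ c‖ := by
  rcases eq_or_ne (φ c) 0 with hφc | hφc
  · exact ⟨0, by simp [hφc]⟩
  have norm_ne_zero : (‖φ c‖ : ℂ) ≠ 0 := by simpa using hφc
  obtain ⟨c', map_c', norm_c'⟩ :=
    exists_map_eq_norm_le_one φ ((‖φ c‖ : ℂ)⁻¹ • c) (by simp [norm_smul, hφc])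
  refine ⟨(‖φ c‖ : ℂ) • c', ?_, ?_⟩
  · rw [map_smul, map_c', map_smul, smul_inv_smul₀ norm_ne_zero]
  · simpa [norm_smul] using mul_le_of_le_one_right (norm_nonneg (φ c)) norm_c'

theorem isClosed_range_nonUnitalStarAlgHom (φ : C →⋆ₙₐ[ℂ] D) : IsClosed (Set.range φ) := by
  let f : NormedAddGroupHom C D := (φ : C →+ D).mkNormedAddGroupHom 1 fun c => by
    simpa using NonUnitalStarAlgHom.norm_apply_le φ c
  have surjectiveOnWith_range : f.SurjectiveOnWith f.range 1 := by
    rintro _ ⟨c, rfl⟩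
    simpa using! exists_map_eq_norm_le φ c
  refine isClosed_of_closure_subset fun d hd => ?_
  obtain ⟨c, hc, -⟩ := controlled_closure_of_complete one_pos one_pos surjectiveOnWith_range d hd
  exact ⟨c, hc⟩

end NormPreservingLifts

/-! ### Generating sets -/

/-- `S` generates `A` as a C*-algebra: the `*`-subalgebra generated by `S` is dense in `A`. -/
def IsCStarGenerating {A : Type u} [NonUnitalCStarAlgebra A] (S : Set A) : Prop :=
  Dense (NonUnitalStarAlgebra.adjoin ℂ S : Set A)

namespace IsCStarGenerating

variable {A : Type u} [NonUnitalCStarAlgebra A] {E : Type v} [NonUnitalCStarAlgebra E] {S : Set A}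

theorem mem_of_isClosed (hS : IsCStarGenerating S) {T : NonUnitalStarSubalgebra ℂ A}
    (hT : IsClosed (T : Set A)) (hST : S ⊆ T) (a : A) : a ∈ T :=
  hT.closure_subset_iff.2 (NonUnitalStarAlgebra.adjoin_le hST) (hS a)

theorem hom_ext (hS : IsCStarGenerating S) {φ ψ : A →⋆ₙₐ[ℂ] E} (h : S.EqOn φ ψ) : φ = ψ :=
  NonUnitalStarAlgHom.ext <| hS.mem_of_isClosed (T := NonUnitalStarAlgHom.equalizer φ ψ)
    (isClosed_eq (map_continuous φ) (map_continuous ψ)) h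

theorem surjective_of_subset_range (hS : IsCStarGenerating S) {φ : E →⋆ₙₐ[ℂ] A}
    (h : S ⊆ Set.range φ) : Function.Surjective φ :=
  hS.mem_of_isClosed (T := NonUnitalStarAlgHom.range φ) (isClosed_range_nonUnitalStarAlgHom φ) h

variable (A) in
theorem exists_contraction_seq [SeparableSpace A] :
    ∃ s : ℕ → A, (∀ n, ‖s n‖ ≤ 1) ∧ IsCStarGenerating (Set.range s) := by
  let r (n : ℕ) : ℝ := max 1 ‖denseSeq A n‖
  have r_pos (n : ℕ) : 0 < r n := by positivity
  refine ⟨fun n => (r n : ℂ)⁻¹ • denseSeq A n, fun n => ?_, (denseRange_denseSeq A).mono ?_⟩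
  · rw [norm_smul, norm_inv, Complex.norm_real, Real.norm_of_nonneg (r_pos n).le,
      inv_mul_le_one₀ (r_pos n)]
    exact le_max_right _ _
  · rintro _ ⟨n, rfl⟩
    rw [← smul_inv_smul₀ (Complex.ofReal_ne_zero.2 (r_pos n).ne') (denseSeq A n)]
    exact SMulMemClass.smul_mem _ (NonUnitalStarAlgebra.subset_adjoin ℂ _ ⟨n, rfl⟩)

end IsCStarGenerating

/-! ### Universal C*-algebras -/

namespace FreeStarAlg

variable {X : Type u} {E : Type v} [NonUnitalSemiring E] [StarRing E]

/-- The value of a word in the letters `x` and `x*` at `x = f x`. -/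
def evalWord (f : X → E) : FreeSemigroup (X ⊕ X) →ₙ* E :=
  FreeSemigroup.lift (Sum.elim f (star ∘ f))

theorem evalWord_starWord (f : X → E) (w : FreeSemigroup (X ⊕ X)) :
    evalWord f (starWord w).unop = star (evalWord f w) := by
  induction w with
  | ih1 l => rcases l with x | x <;> simp [starWord, evalWord]
  | ih2 l w hl hw => simp only [map_mul, MulOpposite.unop_mul, hl, hw, star_mul]

variable [Module ℂ E] [IsScalarTower ℂ E E] [SMulCommClass ℂ E E]

/-- The linear extension of `evalWord f`. -/
def evalHom (f : X → E) : FreeStarAlg X →ₙₐ[ℂ] E := MonoidAlgebra.liftMagma ℂ (evalWord f)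

theorem evalHom_single (f : X → E) (w : FreeSemigroup (X ⊕ X)) (c : ℂ) :
    evalHom f (single w c) = c • evalWord f w :=
  (Finsupp.liftAddHom_apply_single _ w c).trans rfl

variable [StarModule ℂ E]

theorem evalHom_star (f : X → E) (a : FreeStarAlg X) : evalHom f (star a) = star (evalHom f a) := by
  have comp_star : (evalHom f : FreeStarAlg X →+ E).comp (starAddEquiv : _ ≃+ FreeStarAlg X) =
      (starAddEquiv : E ≃+ E).toAddMonoidHom.comp (evalHom f : FreeStarAlg X →+ E) :=
    addHom_ext fun w c => by
      change evalHom f (star (single w c)) = star (evalHom f (single w c))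
      rw [star_single, evalHom_single, evalHom_single, star_smul, evalWord_starWord]
  exact DFunLike.congr_fun comp_star a

/-- The universal property of the free `*`-algebra: the `*`-homomorphism that sends `of x` to
`f x`. -/
def lift (f : X → E) : FreeStarAlg X →⋆ₙₐ[ℂ] E where
  __ := evalHom f
  map_star' := evalHom_star f

theorem lift_of (f : X → E) (x : X) : lift f (of x) = f x := by
  refine (evalHom_single f _ 1).trans ?_
  simp [evalWord]

theorem single_of_inr (x : X) : single (FreeSemigroup.of (Sum.inr x)) 1 = star (of x) := by
  simp [of, star_single, starWord]

theorem adjoin_range_of : NonUnitalStarAlgebra.adjoin ℂ (Set.range (of (X := X))) = ⊤ := by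
  set S := NonUnitalStarAlgebra.adjoin ℂ (Set.range (of (X := X)))
  have of_mem (x : X) : of x ∈ S := NonUnitalStarAlgebra.subset_adjoin ℂ _ ⟨x, rfl⟩
  have single_one_mem (w : FreeSemigroup (X ⊕ X)) : single w 1 ∈ S := by
    induction w with
    | ih1 l =>
      rcases l with x | x
      · exact of_mem x
      · exact single_of_inr x ▸ star_mem (of_mem x)
    | ih2 l w hl hw => simpa only [single_mul, one_mul] using mul_mem hl hw
  refine NonUnitalStarAlgebra.eq_top_iff.2 fun a => ?_
  induction a using MonoidAlgebra.induction_linear with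
  | zero => exact zero_mem S
  | add a b ha hb => exact add_mem ha hb
  | single w c =>
    change single w c ∈ S
    simpa only [smul_single, mul_one] using SMulMemClass.smul_mem c (single_one_mem w)

theorem lift_eq_zero_of_starHomRel {A : Type w} [NonUnitalCStarAlgebra A] {E : Type v}
    [NonUnitalCStarAlgebra E] {j : A → X} {f : X → E} (φ : A →⋆ₙₐ[ℂ] E) (hφ : ∀ a, f (j a) = φ a)
    {r : FreeStarAlg X} (hr : StarHomRel j r) : lift f r = 0 := by
  cases hr <;> simp [lift_of, hφ, map_star]

end FreeStarAlg

namespace UniversalCStar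

variable {X : Type u} {P : CStarPresentation X} {E : Type v} [NonUnitalCStarAlgebra E]

/-- The canonical map `mk` as a `*`-homomorphism on the free `*`-algebra. -/
def mkHom (P : CStarPresentation X) : FreeStarAlg X →⋆ₙₐ[ℂ] UniversalCStar P where
  toFun a := mk (P.toPre a)
  map_smul' c _ := mk_smul c _
  map_zero' := mk_zero
  map_add' _ _ := mk_add _ _
  map_mul' _ _ := mk_mul _ _
  map_star' _ := mk_star _

theorem mkHom_of (x : X) : mkHom P (FreeStarAlg.of x) = of x := rfl

theorem mkHom_eq_zero {r : FreeStarAlg X} (hr : r ∈ P.rel) : mkHom P r = 0 :=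
  norm_eq_zero.1 ((norm_mk (P.toPre r)).trans (P.admissible_maxSeminorm.rel_eq_zero r hr))

theorem norm_of_le (x : X) : ‖(of x : UniversalCStar P)‖ ≤ P.bound x :=
  (norm_mk _).trans_le (P.admissible_maxSeminorm.le_bound x)

theorem isCStarGenerating_range_of :
    IsCStarGenerating (Set.range (of : X → UniversalCStar P)) := by
  have adjoin_eq : NonUnitalStarAlgebra.adjoin ℂ (Set.range (of : X → UniversalCStar P)) =
      (⊤ : NonUnitalStarSubalgebra ℂ (FreeStarAlg X)).map (mkHom P) := by
    rw [← FreeStarAlg.adjoin_range_of, NonUnitalStarAlgHom.map_adjoin, ← Set.range_comp]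
    rfl
  rw [IsCStarGenerating, adjoin_eq]
  exact isDenseInducing_mk.dense.mono (Set.range_subset_iff.2 fun a => ⟨a, trivial, rfl⟩)

theorem hom_ext {φ ψ : UniversalCStar P →⋆ₙₐ[ℂ] E} (h : ∀ x, φ (of x) = ψ (of x)) : φ = ψ :=
  isCStarGenerating_range_of.hom_ext (Set.forall_mem_range.2 h)

theorem admissible_normSeminorm_comp (φ : FreeStarAlg X →⋆ₙₐ[ℂ] E)
    (hb : ∀ x, ‖φ (FreeStarAlg.of x)‖ ≤ P.bound x) (hr : ∀ r ∈ P.rel, φ r = 0) :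
    P.Admissible ((normSeminorm ℂ E).comp (φ : FreeStarAlg X →ₗ[ℂ] E)) where
  mul_le a b := by simpa using norm_mul_le (φ a) (φ b)
  star_mul_self a := by simpa [map_star] using CStarRing.norm_star_mul_self (x := φ a)
  le_bound := hb
  rel_eq_zero r h := by simp [hr r h]

theorem uniformContinuous_of_norm_le (φ : FreeStarAlg X →⋆ₙₐ[ℂ] E)
    (hφ : ∀ a : P.Pre, ‖φ a‖ ≤ ‖a‖) : UniformContinuous fun a : P.Pre => φ a := by
  let F : P.Pre →+ E := (φ : FreeStarAlg X →+ E)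
  exact (AddMonoidHomClass.lipschitz_of_bound F 1 fun a =>
    (hφ a).trans_eq (one_mul _).symm).uniformContinuous

/-- The continuous extension to the universal C*-algebra of a `*`-homomorphism on the free
`*`-algebra which is contractive for the largest admissible seminorm. -/
def extend (φ : FreeStarAlg X →⋆ₙₐ[ℂ] E) (hφ : ∀ a : P.Pre, ‖φ a‖ ≤ ‖a‖) :
    UniversalCStar P →⋆ₙₐ[ℂ] E :=
  let F : UniversalCStar P → E := Completion.extension fun a : P.Pre => φ a
  have hF (a : P.Pre) : F (mk a) = φ a :=
    Completion.extension_coe (uniformContinuous_of_norm_le φ hφ) a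
  have hc : Continuous F := Completion.continuous_extension
  { toFun := F
    map_smul' := fun c a => induction₁ a
      (isClosed_eq (hc.comp (continuous_id.const_smul c)) (hc.const_smul c))
      fun a => by rw [← mk_smul, hF, hF]; exact map_smul φ c a
    map_zero' := by rw [← mk_zero, hF]; exact map_zero φ
    map_add' := fun a b => induction₂ a b (isClosed_eq (by fun_prop) (by fun_prop))
      fun a b => by rw [← mk_add, hF, hF, hF]; exact map_add φ a b
    map_mul' := fun a b => induction₂ a b (isClosed_eq (by fun_prop) (by fun_prop))
      fun a b => by rw [← mk_mul, hF, hF, hF]; exact map_mul φ a b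
    map_star' := fun a => induction₁ a (isClosed_eq (by fun_prop) (by fun_prop))
      fun a => by rw [← mk_star, hF, hF]; exact map_star φ a }

theorem extend_mk (φ : FreeStarAlg X →⋆ₙₐ[ℂ] E) (hφ : ∀ a : P.Pre, ‖φ a‖ ≤ ‖a‖) (a : P.Pre) :
    extend φ hφ (mk a) = φ a :=
  Completion.extension_coe (uniformContinuous_of_norm_le φ hφ) a

/-- The universal property: images `f x` of the generators that satisfy the bounds and the
relations of `P` determine a `*`-homomorphism. -/
def lift (f : X → E) (hb : ∀ x, ‖f x‖ ≤ P.bound x) (hr : ∀ r ∈ P.rel, FreeStarAlg.lift f r = 0) :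
    UniversalCStar P →⋆ₙₐ[ℂ] E :=
  extend (FreeStarAlg.lift f)
    (admissible_normSeminorm_comp _ (by simpa only [FreeStarAlg.lift_of]) hr).le_maxNorm

theorem lift_of (f : X → E) (hb : ∀ x, ‖f x‖ ≤ P.bound x)
    (hr : ∀ r ∈ P.rel, FreeStarAlg.lift f r = 0) (x : X) : lift f hb hr (of x) = f x :=
  (extend_mk ..).trans (FreeStarAlg.lift_of f x)

/-- The `*`-homomorphism `a ↦ of (j a)`, provided that the relations `StarHomRel j` are among those
of `P`. -/
def homOfRel {A : Type v} [NonUnitalCStarAlgebra A] (P : CStarPresentation X) (j : A → X)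
    (h : ∀ r, StarHomRel j r → r ∈ P.rel) : A →⋆ₙₐ[ℂ] UniversalCStar P where
  toFun a := of (j a)
  map_smul' c a := by simpa [sub_eq_zero, mkHom_of] using mkHom_eq_zero (h _ (.smul c a))
  map_zero' := by simpa [sub_eq_zero, mkHom_of] using mkHom_eq_zero (h _ (.smul 0 0))
  map_add' a b := by simpa [sub_eq_zero, mkHom_of] using mkHom_eq_zero (h _ (.add a b))
  map_mul' a b := by simpa [sub_eq_zero, mkHom_of] using mkHom_eq_zero (h _ (.mul a b))
  map_star' a := by simpa [sub_eq_zero, mkHom_of, map_star] using mkHom_eq_zero (h _ (.star a))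

end UniversalCStar

/-! ### Free products -/

namespace FreeProduct

variable {A : Type u} {B : Type v} [NonUnitalCStarAlgebra A] [NonUnitalCStarAlgebra B]
  {E : Type w} [NonUnitalCStarAlgebra E]

/-- The canonical morphism `A → A * B`. -/
def inl : A →⋆ₙₐ[ℂ] FreeProduct A B :=
  UniversalCStar.homOfRel _ Sum.inl fun _ => Or.inl

/-- The canonical morphism `B → A * B`. -/
def inr : B →⋆ₙₐ[ℂ] FreeProduct A B :=
  UniversalCStar.homOfRel _ Sum.inr fun _ => Or.inr

/-- The universal property of the free product: the morphism `A * B → E` with components `φ` and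
`ψ`. -/
def lift (φ : A →⋆ₙₐ[ℂ] E) (ψ : B →⋆ₙₐ[ℂ] E) : FreeProduct A B →⋆ₙₐ[ℂ] E :=
  UniversalCStar.lift (Sum.elim φ ψ)
    (Sum.forall.2 ⟨NonUnitalStarAlgHom.norm_apply_le φ, NonUnitalStarAlgHom.norm_apply_le ψ⟩)
    (by rintro r (hr | hr)
        · exact FreeStarAlg.lift_eq_zero_of_starHomRel (j := Sum.inl) φ (fun _ => rfl) hr
        · exact FreeStarAlg.lift_eq_zero_of_starHomRel (j := Sum.inr) ψ (fun _ => rfl) hr)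

@[simp]
theorem lift_inl (φ : A →⋆ₙₐ[ℂ] E) (ψ : B →⋆ₙₐ[ℂ] E) (a : A) : lift φ ψ (inl a) = φ a :=
  UniversalCStar.lift_of (Sum.elim φ ψ) _ _ (Sum.inl a)

@[simp]
theorem lift_inr (φ : A →⋆ₙₐ[ℂ] E) (ψ : B →⋆ₙₐ[ℂ] E) (b : B) : lift φ ψ (inr b) = ψ b :=
  UniversalCStar.lift_of (Sum.elim φ ψ) _ _ (Sum.inr b)

theorem hom_ext {φ ψ : FreeProduct A B →⋆ₙₐ[ℂ] E} (hl : ∀ a, φ (inl a) = ψ (inl a))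
    (hr : ∀ b, φ (inr b) = ψ (inr b)) : φ = ψ :=
  UniversalCStar.hom_ext (Sum.forall.2 ⟨hl, hr⟩)

end FreeProduct

theorem IsCStarGenerating.freeProduct {A : Type u} {B : Type v} [NonUnitalCStarAlgebra A]
    [NonUnitalCStarAlgebra B] {S : Set A} {T : Set B} (hS : IsCStarGenerating S)
    (hT : IsCStarGenerating T) :
    IsCStarGenerating (FreeProduct.inl (B := B) '' S ∪ FreeProduct.inr (A := A) '' T) := by
  set U := FreeProduct.inl (B := B) '' S ∪ FreeProduct.inr (A := A) '' T
  let M := (NonUnitalStarAlgebra.adjoin ℂ U).topologicalClosure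
  have isClosed_M : IsClosed (M : Set (FreeProduct A B)) :=
    NonUnitalStarSubalgebra.isClosed_topologicalClosure _
  have subset_M : U ⊆ M := (NonUnitalStarAlgebra.subset_adjoin ℂ U).trans subset_closure
  refine UniversalCStar.isCStarGenerating_range_of.mem_of_isClosed isClosed_M ?_
  rintro _ ⟨a | b, rfl⟩
  · exact hS.mem_of_isClosed (T := M.comap FreeProduct.inl)
      (isClosed_M.preimage (map_continuous FreeProduct.inl))
      (fun s hs => subset_M (.inl ⟨s, hs, rfl⟩)) a
  · exact hT.mem_of_isClosed (T := M.comap FreeProduct.inr)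
      (isClosed_M.preimage (map_continuous FreeProduct.inr))
      (fun t ht => subset_M (.inr ⟨t, ht, rfl⟩)) b

/-! ### Lifting along surjections -/

/-- Every morphism `B → D` lifts along every surjective morphism `C → D`. This is projectivity of
`B`, except that the C*-algebras `C` and `D` may live in another universe than `B`. -/
def LiftsAlongSurjections (B : Type v) [NonUnitalCStarAlgebra B] : Prop :=
  ∀ ⦃C D : Type w⦄ [NonUnitalCStarAlgebra C] [NonUnitalCStarAlgebra D] (π : C →⋆ₙₐ[ℂ] D),
    Function.Surjective π → ∀ σ : B →⋆ₙₐ[ℂ] D, ∃ ψ : B →⋆ₙₐ[ℂ] C, π.comp ψ = σ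

theorem isProjectiveCStar_iff {A : Type u} [NonUnitalCStarAlgebra A] :
    IsProjectiveCStar A ↔ LiftsAlongSurjections.{u, u} A := by
  refine ⟨fun h C D _ _ π hπ σ => ?_, fun h C D _ _ J _ π hπ σ => h π hπ.1 σ⟩
  have isClosed_ker : IsClosed (TwoSidedIdeal.ker π : Set C) := by
    convert isClosed_singleton.preimage (map_continuous π) (t := {0})
    exact Set.ext fun _ => TwoSidedIdeal.mem_ker π
  exact h C D _ isClosed_ker π ⟨hπ, fun _ => (TwoSidedIdeal.mem_ker π).symm⟩ σ

namespace LiftsAlongSurjections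

theorem universalCStar {X : Type u} {P : CStarPresentation X} (hP : P.rel = ∅) :
    LiftsAlongSurjections.{u, w} (UniversalCStar P) := by
  intro C D _ _ π hπ σ
  have exists_lift_of (x : X) : ∃ c, π c = σ (.of x) ∧ ‖c‖ ≤ P.bound x := by
    obtain ⟨c₀, hc₀⟩ := hπ (σ (.of x))
    obtain ⟨c, hc, norm_c⟩ := exists_map_eq_norm_le π c₀
    rw [hc₀] at hc norm_c
    exact ⟨c, hc, norm_c.trans <|
      (NonUnitalStarAlgHom.norm_apply_le σ _).trans (UniversalCStar.norm_of_le x)⟩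
  choose f hf norm_f using exists_lift_of
  refine ⟨UniversalCStar.lift f norm_f (by simp [hP]), UniversalCStar.hom_ext fun x => ?_⟩
  rw [NonUnitalStarAlgHom.comp_apply, UniversalCStar.lift_of, hf]

theorem freeProduct {A : Type u} {B : Type v} [NonUnitalCStarAlgebra A] [NonUnitalCStarAlgebra B]
    (hA : LiftsAlongSurjections.{u, w} A) (hB : LiftsAlongSurjections.{v, w} B) :
    LiftsAlongSurjections.{max u v, w} (FreeProduct A B) := by
  intro C D _ _ π hπ σ
  obtain ⟨ψA, hψA⟩ := hA π hπ (σ.comp FreeProduct.inl)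
  obtain ⟨ψB, hψB⟩ := hB π hπ (σ.comp FreeProduct.inr)
  refine ⟨FreeProduct.lift ψA ψB, FreeProduct.hom_ext (fun a => ?_) (fun b => ?_)⟩
  · simpa using DFunLike.congr_fun hψA a
  · simpa using DFunLike.congr_fun hψB b

end LiftsAlongSurjections

theorem IsSemiprojectiveCStar.freeProduct {A : Type (max u v)} {B : Type v}
    [NonUnitalCStarAlgebra A] [NonUnitalCStarAlgebra B] (hA : IsSemiprojectiveCStar A)
    (hB : LiftsAlongSurjections.{v, max u v} B) : IsSemiprojectiveCStar (FreeProduct A B) := by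
  intro C D _ _ Q _ J hJ_mono hJ_closed q hq π hπ σ
  obtain ⟨k, ψA, ρ, hρ, hψA⟩ := hA C D Q J hJ_mono hJ_closed q hq π hπ (σ.comp FreeProduct.inl)
  have ρ_surjective : Function.Surjective ρ := by
    refine .of_comp (g := q k) ?_
    rw [← NonUnitalStarAlgHom.coe_comp, hρ]
    exact hπ.1
  obtain ⟨ψB, hψB⟩ := hB ρ ρ_surjective (σ.comp FreeProduct.inr)
  refine ⟨k, FreeProduct.lift ψA ψB, ρ, hρ, FreeProduct.hom_ext (fun a => ?_) (fun b => ?_)⟩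
  · simpa using DFunLike.congr_fun hψA a
  · simpa using DFunLike.congr_fun hψB b

theorem FInfty.liftsAlongSurjections : LiftsAlongSurjections.{0, w} FInfty :=
  .universalCStar rfl

/-! ### Inductive limits -/

namespace InductiveLimit

variable {A : ℕ → Type u} [∀ k, NonUnitalCStarAlgebra (A k)] (γ : ∀ k, A k →⋆ₙₐ[ℂ] A (k + 1))
  {E : Type v} [NonUnitalCStarAlgebra E]

/-- The canonical morphism from `A k` to the inductive limit. -/
def incl (k : ℕ) : A k →⋆ₙₐ[ℂ] InductiveLimit γ :=
  UniversalCStar.homOfRel _ (Sigma.mk k) fun _ hr => Or.inl ⟨k, hr⟩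

theorem incl_succ_apply (k : ℕ) (a : A k) : incl γ (k + 1) (γ k a) = incl γ k a := by
  have mkHom_sub := UniversalCStar.mkHom_eq_zero (P := inductiveLimitPres γ) (.inr ⟨k, a, rfl⟩)
  rwa [map_sub, sub_eq_zero] at mkHom_sub

variable {γ}

/-- The universal property of the inductive limit: the morphism with components `φ k`. -/
def lift (φ : ∀ k, A k →⋆ₙₐ[ℂ] E) (hφ : ∀ k a, φ (k + 1) (γ k a) = φ k a) :
    InductiveLimit γ →⋆ₙₐ[ℂ] E :=
  UniversalCStar.lift (fun x => φ x.1 x.2) (fun x => NonUnitalStarAlgHom.norm_apply_le (φ x.1) x.2)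
    (by rintro r (⟨k, hr⟩ | ⟨k, a, rfl⟩)
        · exact FreeStarAlg.lift_eq_zero_of_starHomRel (j := Sigma.mk k) (φ k) (fun _ => rfl) hr
        · rw [map_sub, FreeStarAlg.lift_of, FreeStarAlg.lift_of, sub_eq_zero, hφ])

@[simp]
theorem lift_incl (φ : ∀ k, A k →⋆ₙₐ[ℂ] E) (hφ : ∀ k a, φ (k + 1) (γ k a) = φ k a) (k : ℕ)
    (a : A k) : lift φ hφ (incl γ k a) = φ k a :=
  UniversalCStar.lift_of (fun x : Σ k, A k => φ x.1 x.2) _ _ ⟨k, a⟩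

theorem hom_ext {φ ψ : InductiveLimit γ →⋆ₙₐ[ℂ] E}
    (h : ∀ k a, φ (incl γ k a) = ψ (incl γ k a)) : φ = ψ :=
  UniversalCStar.hom_ext fun x => h x.1 x.2

variable {B : ℕ → Type v} [∀ k, NonUnitalCStarAlgebra (B k)] {δ : ∀ k, B k →⋆ₙₐ[ℂ] B (k + 1)}

/-- The morphism of inductive limits induced by a morphism of inductive systems. -/
def map (ι : ∀ k, A k →⋆ₙₐ[ℂ] B k) (hι : ∀ k a, δ k (ι k a) = ι (k + 1) (γ k a)) :
    InductiveLimit γ →⋆ₙₐ[ℂ] InductiveLimit δ :=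
  lift (fun k => (incl δ k).comp (ι k)) fun k a => by
    simp only [NonUnitalStarAlgHom.comp_apply, ← hι, incl_succ_apply]

@[simp]
theorem map_incl (ι : ∀ k, A k →⋆ₙₐ[ℂ] B k) (hι : ∀ k a, δ k (ι k a) = ι (k + 1) (γ k a)) (k : ℕ)
    (a : A k) : map ι hι (incl γ k a) = incl δ k (ι k a) :=
  lift_incl ..

/-- The isomorphism of inductive limits induced by a morphism `ι` of inductive systems, given a
cocone `τ` on the target system that provides the inverse. -/
def equivOfCocone (ι : ∀ k, A k →⋆ₙₐ[ℂ] B k) (hι : ∀ k a, δ k (ι k a) = ι (k + 1) (γ k a))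
    (τ : ∀ k, B k →⋆ₙₐ[ℂ] InductiveLimit γ) (hτ : ∀ k b, τ (k + 1) (δ k b) = τ k b)
    (hτι : ∀ k a, τ k (ι k a) = incl γ k a) (hιτ : ∀ k b, map ι hι (τ k b) = incl δ k b) :
    InductiveLimit γ ≃⋆ₐ[ℂ] InductiveLimit δ :=
  StarAlgEquiv.ofNonUnitalStarAlgHom (map ι hι) (lift τ hτ)
    (hom_ext fun k a => by simp [hτι]) (hom_ext fun k b => by simp [hιτ])

end InductiveLimit

/-! ### The surjective inductive system -/

namespace FInfty

variable {E : Type v} [NonUnitalCStarAlgebra E]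

/-- The generators of `FInfty`, arranged as a double sequence. -/
def gen (i j : ℕ) : FInfty := UniversalCStar.of (Nat.pair i j)

theorem gen_unpair (n : ℕ) : gen n.unpair.1 n.unpair.2 = UniversalCStar.of n := by
  rw [gen, Nat.pair_unpair]

theorem norm_gen_le (i j : ℕ) : ‖gen i j‖ ≤ 1 := UniversalCStar.norm_of_le _

/-- The morphism on `FInfty` given by a double sequence of contractions. -/
def lift (f : ℕ → ℕ → E) (hf : ∀ i j, ‖f i j‖ ≤ 1) : FInfty →⋆ₙₐ[ℂ] E :=
  UniversalCStar.lift (fun n => f n.unpair.1 n.unpair.2) (fun _ => hf _ _)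
    fun r hr => absurd hr (Set.notMem_empty r)

@[simp]
theorem lift_gen (f : ℕ → ℕ → E) (hf : ∀ i j, ‖f i j‖ ≤ 1) (i j : ℕ) :
    lift f hf (gen i j) = f i j :=
  (UniversalCStar.lift_of (fun n : ℕ => f n.unpair.1 n.unpair.2) _ _ _).trans <| by
    rw [Nat.unpair_pair]

theorem hom_ext {φ ψ : FInfty →⋆ₙₐ[ℂ] E} (h : ∀ i j, φ (gen i j) = ψ (gen i j)) : φ = ψ :=
  UniversalCStar.hom_ext fun n => gen_unpair n ▸ h _ _

theorem freeProduct_hom_ext {A : Type u} [NonUnitalCStarAlgebra A]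
    {φ ψ : FreeProduct A FInfty →⋆ₙₐ[ℂ] E}
    (hl : ∀ a, φ (FreeProduct.inl a) = ψ (FreeProduct.inl a))
    (hr : ∀ i j, φ (FreeProduct.inr (gen i j)) = ψ (FreeProduct.inr (gen i j))) : φ = ψ :=
  FreeProduct.hom_ext hl <| DFunLike.congr_fun <|
    hom_ext (φ := φ.comp FreeProduct.inr) (ψ := ψ.comp FreeProduct.inr) hr

end FInfty

section ConnectingHom

variable {A : Type u} {B : Type v} [NonUnitalCStarAlgebra A] [NonUnitalCStarAlgebra B]

/-- The images of the generators of `FInfty` under `connectingHom`: the row `0` enumerates the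
given contractions `s` of `B`, and every other row is shifted down by one. -/
def shiftedGen (s : ℕ → B) : ℕ → ℕ → FreeProduct B FInfty
  | 0, j => FreeProduct.inl (s j)
  | i + 1, j => FreeProduct.inr (FInfty.gen i j)

theorem norm_shiftedGen_le {s : ℕ → B} (hs : ∀ j, ‖s j‖ ≤ 1) : ∀ i j, ‖shiftedGen s i j‖ ≤ 1
  | 0, j => (NonUnitalStarAlgHom.norm_apply_le _ _).trans (hs j)
  | i + 1, j => (NonUnitalStarAlgHom.norm_apply_le _ _).trans (FInfty.norm_gen_le i j)

variable (γ : A →⋆ₙₐ[ℂ] B) {s : ℕ → B} (hs : ∀ j, ‖s j‖ ≤ 1)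

/-- The morphism `A * F∞ → B * F∞` that extends `γ` and shifts the generators of `F∞`, where `s` is
a sequence of contractions of `B`. -/
def connectingHom : FreeProduct A FInfty →⋆ₙₐ[ℂ] FreeProduct B FInfty :=
  FreeProduct.lift (FreeProduct.inl.comp γ) (FInfty.lift (shiftedGen s) (norm_shiftedGen_le hs))

@[simp]
theorem connectingHom_inl (a : A) :
    connectingHom γ hs (FreeProduct.inl a) = FreeProduct.inl (γ a) :=
  FreeProduct.lift_inl ..

@[simp]
theorem connectingHom_inr_gen (i j : ℕ) :
    connectingHom γ hs (FreeProduct.inr (FInfty.gen i j)) = shiftedGen s i j := by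
  rw [connectingHom, FreeProduct.lift_inr, FInfty.lift_gen]

theorem connectingHom_surjective (hgen : IsCStarGenerating (Set.range s)) :
    Function.Surjective (connectingHom γ hs) := by
  refine (hgen.freeProduct UniversalCStar.isCStarGenerating_range_of).surjective_of_subset_range ?_
  rintro _ (⟨_, ⟨j, rfl⟩, rfl⟩ | ⟨_, ⟨n, rfl⟩, rfl⟩)
  · exact ⟨FreeProduct.inr (FInfty.gen 0 j), connectingHom_inr_gen γ hs 0 j⟩
  · rw [← FInfty.gen_unpair]
    exact ⟨FreeProduct.inr (FInfty.gen (n.unpair.1 + 1) n.unpair.2),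
      connectingHom_inr_gen γ hs _ _⟩

end ConnectingHom

section ConnectingLimit

variable {A : ℕ → Type u} [∀ k, NonUnitalCStarAlgebra (A k)] (γ : ∀ k, A k →⋆ₙₐ[ℂ] A (k + 1))
  {s : ∀ k, ℕ → A k} (hs : ∀ k j, ‖s k j‖ ≤ 1)

/-- The inductive system formed by the morphisms `connectingHom`. -/
def connectingSystem (k : ℕ) : FreeProduct (A k) FInfty →⋆ₙₐ[ℂ] FreeProduct (A (k + 1)) FInfty :=
  connectingHom (γ k) (hs (k + 1))

/-- The morphism `A k * F∞ → lim A k` that sends each generator of `F∞` to the element of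
`A (k + i + 1)` that it becomes after `i + 1` connecting morphisms. -/
def toLimit (k : ℕ) : FreeProduct (A k) FInfty →⋆ₙₐ[ℂ] InductiveLimit γ :=
  FreeProduct.lift (InductiveLimit.incl γ k)
    (FInfty.lift (fun i j => InductiveLimit.incl γ (k + i + 1) (s (k + i + 1) j)) fun i j =>
      (NonUnitalStarAlgHom.norm_apply_le _ _).trans (hs (k + i + 1) j))

@[simp]
theorem toLimit_inl (k : ℕ) (a : A k) :
    toLimit γ hs k (FreeProduct.inl a) = InductiveLimit.incl γ k a :=
  FreeProduct.lift_inl ..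

@[simp]
theorem toLimit_inr_gen (k i j : ℕ) : toLimit γ hs k (FreeProduct.inr (FInfty.gen i j)) =
    InductiveLimit.incl γ (k + i + 1) (s (k + i + 1) j) := by
  rw [toLimit, FreeProduct.lift_inr, FInfty.lift_gen]

theorem toLimit_comp_connectingSystem (k : ℕ) :
    (toLimit γ hs (k + 1)).comp (connectingSystem γ hs k) = toLimit γ hs k := by
  refine FInfty.freeProduct_hom_ext (fun a => ?_) (fun i j => ?_)
  · simp [connectingSystem, InductiveLimit.incl_succ_apply]
  · cases i with
    | zero => simp [connectingSystem, shiftedGen]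
    | succ i => 
      simp only [NonUnitalStarAlgHom.comp_apply, connectingSystem, connectingHom_inr_gen,
        shiftedGen, toLimit_inr_gen]
      rw [add_assoc k 1 i, add_comm 1 i]

/-- The limit `lim (A k * F∞)` of the connecting system. -/
abbrev ConnectingLimit : Type u :=
  InductiveLimit (A := fun k => FreeProduct (A k) FInfty) (connectingSystem γ hs)

/-- The canonical morphism from `A k * F∞` to the limit of the connecting system. -/
def connectingIncl (k : ℕ) : FreeProduct (A k) FInfty →⋆ₙₐ[ℂ] ConnectingLimit γ hs :=
  InductiveLimit.incl (A := fun k => FreeProduct (A k) FInfty) (connectingSystem γ hs) k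

theorem connectingIncl_succ_apply (k : ℕ) (b : FreeProduct (A k) FInfty) :
    connectingIncl γ hs (k + 1) (connectingSystem γ hs k b) = connectingIncl γ hs k b :=
  InductiveLimit.incl_succ_apply (A := fun k => FreeProduct (A k) FInfty) _ k b

theorem connectingIncl_inr_gen (k i j : ℕ) :
    connectingIncl γ hs k (FreeProduct.inr (FInfty.gen i j)) =
      connectingIncl γ hs (k + i + 1) (FreeProduct.inl (s (k + i + 1) j)) := by
  induction i generalizing k with
  | zero => simp [← connectingIncl_succ_apply γ hs k, connectingSystem, shiftedGen]
  | succ i ih =>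
    rw [← connectingIncl_succ_apply, connectingSystem, connectingHom_inr_gen, shiftedGen, ih,
      add_assoc k 1 i, add_comm 1 i]

/-- The morphism `lim A k → lim (A k * F∞)` induced by the inclusions of the first factors. -/
def toConnectingLimit : InductiveLimit γ →⋆ₙₐ[ℂ] ConnectingLimit γ hs :=
  InductiveLimit.map (B := fun k => FreeProduct (A k) FInfty) (fun _ => FreeProduct.inl)
    fun k => connectingHom_inl (γ k) (hs (k + 1))

@[simp]
theorem toConnectingLimit_incl (k : ℕ) (a : A k) :
    toConnectingLimit γ hs (InductiveLimit.incl γ k a) =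
      connectingIncl γ hs k (FreeProduct.inl a) :=
  InductiveLimit.map_incl (B := fun k => FreeProduct (A k) FInfty) _ _ k a

theorem toConnectingLimit_comp_toLimit (k : ℕ) :
    (toConnectingLimit γ hs).comp (toLimit γ hs k) = connectingIncl γ hs k :=
  FInfty.freeProduct_hom_ext (fun a => by simp) fun i j => by simp [connectingIncl_inr_gen γ hs k]

/-- The isomorphism `lim A k ≅ lim (A k * F∞)`. -/
def limitEquivConnectingLimit : InductiveLimit γ ≃⋆ₐ[ℂ] ConnectingLimit γ hs :=
  InductiveLimit.equivOfCocone (B := fun k => FreeProduct (A k) FInfty)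
    (fun _ => FreeProduct.inl) (fun k => connectingHom_inl (γ k) (hs (k + 1))) (toLimit γ hs)
    (fun k => DFunLike.congr_fun (toLimit_comp_connectingSystem γ hs k)) (toLimit_inl γ hs)
    (fun k => DFunLike.congr_fun (toConnectingLimit_comp_toLimit γ hs k))

end ConnectingLimit

end

theorem mainTheorem9 {A : ℕ → Type u} [∀ k, NonUnitalCStarAlgebra (A k)]
    [∀ k, TopologicalSpace.SeparableSpace (A k)] (γ : ∀ k, A k →⋆ₙₐ[ℂ] A (k + 1)) :
    (∃ δ : ∀ k, FreeProduct (A k) FInfty →⋆ₙₐ[ℂ] FreeProduct (A (k + 1)) FInfty,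
      (∀ k, Function.Surjective (δ k)) ∧
      Nonempty (InductiveLimit γ ≃⋆ₐ[ℂ]
        InductiveLimit (A := fun k => FreeProduct (A k) FInfty) δ)) ∧
    (∀ k, IsProjectiveCStar (A k) → IsProjectiveCStar (FreeProduct (A k) FInfty)) ∧
    (∀ k, IsSemiprojectiveCStar (A k) → IsSemiprojectiveCStar (FreeProduct (A k) FInfty)) := by
  choose s hs hgen using fun k => IsCStarGenerating.exists_contraction_seq (A k)
  refine ⟨⟨connectingSystem γ hs, fun k => connectingHom_surjective (γ k) _ (hgen (k + 1)),
    ⟨limitEquivConnectingLimit γ hs⟩⟩, fun k hA => ?_, fun k hA => ?_⟩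
  · exact isProjectiveCStar_iff.2
      ((isProjectiveCStar_iff.1 hA).freeProduct FInfty.liftsAlongSurjections)
  · exact hA.freeProduct FInfty.liftsAlongSurjections
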